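/- A word $v$ is an $e$-power of a non-empty word $u$ if $v$ is a prefix of $uuu\cdots$ and $e=|v|/|u|$; then $v$ is called a repetition of exponent $e$. A (finite, infinite or bi-infinite) word is $\alpha$-free (resp. $\alpha^+$-free) if it has no factor that is a repetition of exponent $\ge\alpha$ (resp. $>\alpha$). Numbers of palindromes count distinct finite palindromic factors, including the empty word. Let $t$ be the morphism on $\{0,1,2\}^*$ given by $t(0)=01120$, $t(1)=12001$, $t(2)=2$, and let $t^\omega(0)$ be the infinite word that has every $t^n(0)$, $n\ge 0$, as a prefix. Theorem 5. The word $t^\omega(0)$ contains exactly 6 palindromes and is $2^+$-free. Moreover, every bi-infinite $\tfrac94$-free word over $\{0,1,2\}$ containing at most 6 palindromes has the same set of finite factors as one of the six words obtained from $t^\omega(0)$ by applying a permutation of the letters $0,1,2$. -/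

import Mathlib

namespace PalWords

/-- The set of finite factors of the right-infinite word `u`, the empty word included. -/
def factors {α : Type*} (u : ℕ → α) : Set (List α) :=
  {w | ∃ i n : ℕ, w = (List.range n).map (fun k : ℕ => u (i + k))}

/-- The set of finite factors of the bi-infinite word `u`, the empty word included. -/
def biFactors {α : Type*} (u : ℤ → α) : Set (List α) :=
  {w | ∃ (i : ℤ) (n : ℕ), w = (List.range n).map (fun k : ℕ => u (i + (k : ℤ)))}

/-- `v` is an `e`-power of the nonempty word `u`: `v` is a prefix of the periodic word
`u u u ⋯`, and `e = |v| / |u|`. -/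
def IsPower {α : Type*} (v u : List α) (e : ℚ) : Prop :=
  u ≠ [] ∧ (∀ i < v.length, v[i]? = u[i % u.length]?) ∧
    e = (v.length : ℚ) / (u.length : ℚ)

/-- A word with factor set `L` is `a`-free: it contains no repetition of exponent `≥ a`. -/
def PowerFree {α : Type*} (a : ℚ) (L : Set (List α)) : Prop :=
  ∀ v ∈ L, ∀ (u : List α) (e : ℚ), IsPower v u e → e < a

/-- A word with factor set `L` is `a⁺`-free: it contains no repetition of exponent `> a`. -/
def PowerPlusFree {α : Type*} (a : ℚ) (L : Set (List α)) : Prop :=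
  ∀ v ∈ L, ∀ (u : List α) (e : ℚ), IsPower v u e → e ≤ a

/-- The number of distinct palindromes (the empty word included) in the factor set `L`. -/
noncomputable def numPalindromes {α : Type*} (L : Set (List α)) : ℕ∞ :=
  {w ∈ L | w.Palindrome}.encard

/-- The extension to finite words of the morphism with letter images `f`. -/
def morph {α β : Type*} (f : α → List β) (w : List α) : List β := w.flatMap f

/-- The letter images of the morphism `t`: `0 ↦ 01120`, `1 ↦ 12001`, `2 ↦ 2`. -/
def t : Fin 3 → List (Fin 3) :=
  ![[0, 1, 1, 2, 0], [1, 2, 0, 0, 1], [2]]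

/-- The infinite word `t^ω(0)`, the limit of the words `tⁿ(0)`: its letter at position `n` is the
one of `tⁿ(0)`, which has more than `n` letters (see `tOmega_spec`). -/
def tOmega (n : ℕ) : Fin 3 := ((morph t)^[n] [0]).getD n 0

theorem iterate_succ_eq (n : ℕ) : ∃ x : List (Fin 3), x ≠ [] ∧
    (morph t)^[n + 1] [0] = (morph t)^[n] [0] ++ x := by
  induction n with
  | zero => exact ⟨[1, 1, 2, 0], by decide, by decide⟩
  | succ n ih =>
    obtain ⟨x, hx, h⟩ := ih
    refine ⟨morph t x, ?_, ?_⟩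
    · obtain ⟨a, l, rfl⟩ := List.exists_cons_of_ne_nil hx
      fin_cases a <;> simp [morph, t]
    · rw [Function.iterate_succ_apply' _ (n + 1), h]
      nth_rw 2 [← h]
      rw [Function.iterate_succ_apply']
      exact List.flatMap_append

theorem iterate_prefix {m n : ℕ} (h : m ≤ n) :
    (morph t)^[m] [0] <+: (morph t)^[n] [0] := by
  induction n, h using Nat.le_induction with
  | base => exact List.prefix_rfl
  | succ n _ ih =>
    obtain ⟨x, -, hx⟩ := iterate_succ_eq n
    exact ih.trans ⟨x, hx.symm⟩

theorem lt_length_iterate (n : ℕ) : n < ((morph t)^[n] [0]).length := by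
  induction n with
  | zero => simp
  | succ n ih =>
    obtain ⟨x, hx, h⟩ := iterate_succ_eq n
    have := List.length_pos_iff.2 hx
    rw [h, List.length_append]
    omega

/-- Every `tⁿ(0)` is a prefix of `t^ω(0)`. -/
theorem tOmega_spec (n k : ℕ) (hk : k < ((morph t)^[n] [0]).length) :
    ((morph t)^[n] [0])[k] = tOmega k := by
  have hk' := lt_length_iterate k
  rw [tOmega, List.getD_eq_getElem _ _ hk']
  rcases le_total n k with h | h
  · exact (iterate_prefix h).getElem hk
  · exact ((iterate_prefix h).getElem hk').symm

end PalWords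

namespace PalWords

/-! Uniqueness. A finite search shows that a 9/4-free word with at most six palindromes has exactly
the empty word, the three letters and two squares of letters (`palindromes_eq_sixPals`). Rename
letters so that the squares are 00 and 11. As no aba, abba, aaa or 22 occurs, changes of letter
always turn the same way around the alphabet, and swapping 0 and 1 if necessary makes this 0 → 1 → 2
→ 0 (`exists_perm_good`).

In such words the boundaries between blocks t(a) can be read off locally, by a second search, so
every factor is t(v) up to bounded ends (`Good.exists_morph`). Since t is not uniform, exponents
need not survive it; the hypothesis is therefore weakened to `HeavyFree`, which bounds repetitions
in two weights at once and passes from t(v) to v. Hence desubstitution can be iterated. A factor of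
length at most 4^n of t^n(v) already lies in t^n(x) with |x| ≤ 3, and every admissible x of that
length occurs in t^ω(0); conversely a good v with four letters contains 0. This gives equal factor
sets (`biFactors_eq_factors_tOmega`).

Existence. Palindromes of t^ω(0) are found by peeling off outer letters. An overlap of period above
10 contains a recognisable boundary and desubstitutes to an overlap of smaller period; short periods
are checked directly (`tOmega_no_overlap`). -/

/-- Searches the words of length at most `n + |w|` that end in `w`, abandoning a branch as soon as
`halt` holds; `true` means that every branch has been abandoned. -/
def leftSearch {α : Type*} (halt : List α → Bool) (alphabet : List α) : ℕ → List α → Bool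
  | 0, _ => false
  | n + 1, w => alphabet.all fun a => halt (a :: w) || leftSearch halt alphabet n (a :: w)

theorem exists_suffix_of_leftSearch {α : Type*} {halt : List α → Bool} {alphabet : List α}
    (hα : ∀ a, a ∈ alphabet) {n : ℕ} {w : List α} (h : leftSearch halt alphabet n w = true)
    {v : List α} (hv : v.length = n) : ∃ x, x <:+ v ∧ halt (x ++ w) = true := by
  induction n generalizing w v with
  | zero => simp [leftSearch] at h
  | succ n ih =>
    obtain rfl | ⟨v, a, rfl⟩ := v.eq_nil_or_concat
    · simp at hv
    · simp only [leftSearch, List.all_eq_true, Bool.or_eq_true] at h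
      rcases h a (hα a) with h | h
      · exact ⟨[a], by simp, by simpa using h⟩
      · obtain ⟨x, hx, hs⟩ := ih h (v := v) (by simpa using hv)
        exact ⟨x ++ [a], by obtain ⟨y, rfl⟩ := hx; exact ⟨y, by simp⟩, by simpa using hs⟩

/-! ### The two finite searches -/

/-- The local rule that recognises a boundary between two images of letters under `t`; the left
context `l` is reversed. -/
def cut (l r : List (Fin 3)) : Bool :=
  [([0, 2, 1, 1], [0, 1, 1]), ([0, 2], [1, 2]), ([1, 0, 0], [1, 2, 0, 0]), ([1, 0, 0], [2, 0, 1]),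
    ([2], [0, 1, 1])].any fun q => q.1.isPrefixOf l && q.2.isPrefixOf r

def cutAt (w : List (Fin 3)) (i : ℕ) : Bool := cut (w.take i).reverse (w.drop i)

/-- Four pairs that violate the cyclic order, then ten words `p s p s p` with `Heavy p s`: enough to
make the boundary search terminate. -/
def forbidden : List (List (Fin 3)) :=
  [[0, 2], [1, 0], [2, 1], [2, 2], [0, 0, 0], [1, 1, 1], [1, 2, 0, 1, 2, 0, 1],
    [0, 1, 2, 0, 1, 2, 0], [0, 1, 1, 2, 0, 1, 1, 2, 0], [1, 2, 0, 0, 1, 2, 0, 0, 1],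
    [0, 1, 1, 2, 0, 0, 1, 1, 2, 0, 0, 1], [1, 2, 0, 0, 1, 1, 2, 0, 0, 1, 1, 2],
    [0, 1, 1, 2, 0, 1, 2, 0, 0, 1, 1, 2, 0, 1, 2, 0, 0, 1],
    [1, 2, 0, 0, 1, 2, 0, 1, 1, 2, 0, 0, 1, 2, 0, 1, 1, 2, 0]]

def startsForbidden (w : List (Fin 3)) : Bool := forbidden.any fun f => f.isPrefixOf w

/-- In a word of length `25`, there is a boundary at one of the positions `10, …, 14`, and a boundary
at `10` is followed by the image of a letter and a further boundary. -/
def cutStep (w : List (Fin 3)) : Bool :=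
  ((List.range 5).any fun j => cutAt w (10 + j)) &&
    (!cutAt w 10 || [0, 1, 2].any fun a => (t a).isPrefixOf (w.drop 10) &&
      cutAt w (10 + (t a).length))

theorem leftSearch_cutStep : leftSearch (fun w => startsForbidden w ||
    (w.length == 25 && cutStep w)) [0, 1, 2] 25 [] = true := by
  decide +kernel

/-- `x` and `y` have length at least `n` and the same first `n` letters. -/
def agree : ℕ → List (Fin 3) → List (Fin 3) → Bool
  | 0, _, _ => true
  | n + 1, a :: x, b :: y => a == b && agree n x y
  | _ + 1, _, _ => false

/-- Some prefix of `w` is a repetition of exponent at least `9/4` and period at most `6`. -/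
def startsRep (w : List (Fin 3)) : Bool :=
  [(1, 2), (2, 3), (3, 4), (4, 5), (5, 7), (6, 8)].any fun q => agree q.2 (w.drop q.1) w

def isPal (w : List (Fin 3)) : Bool := w.reverse == w

/-- The distinct palindromic factors of length at most `6`. -/
def shortPals : List (Fin 3) → List (List (Fin 3))
  | [] => [[]]
  | a :: w => ((([1, 2, 3, 4, 5, 6].map fun k => (a :: w).take k)).filter
      isPal).foldr List.insert (shortPals w)

def sixPals (a b : Fin 3) : List (List (Fin 3)) :=
  [[], [0], [1], [2], [a, a], [b, b]]

/-- The costly count is made only when a palindrome of length 2 to 6 has just appeared at the front.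
The guard only makes halting rarer, so it cannot affect soundness. -/
def haltPals (w : List (Fin 3)) : Bool :=
  startsRep w || (([2, 3, 4, 5, 6].any fun k => isPal (w.take k)) &&
    (7 ≤ (shortPals w).length ||
      [(0, 1), (0, 2), (1, 2)].any fun q => (sixPals q.1 q.2).all fun x => (shortPals w).elem x))

theorem leftSearch_haltPals : leftSearch haltPals [0, 1, 2] 19 [] = true := by
  decide +kernel

/-! ### Soundness of the searches: repetitions and palindromes -/

variable {α : Type*}

theorem isPower_of_period {v : List α} {p : ℕ} (hp : 0 < p) (hpv : p ≤ v.length)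
    (h : ∀ i, i + p < v.length → v[i + p]? = v[i]?) :
    IsPower v (v.take p) ((v.length : ℚ) / p) := by
  have hl : (v.take p).length = p := by simp [hpv]
  refine ⟨fun h0 => by simp [h0] at hl; omega, fun i hi => ?_, by rw [hl]⟩
  rw [hl]
  induction i using Nat.strong_induction_on with
  | _ i ih =>
    rcases lt_or_ge i p with hip | hip
    · rw [Nat.mod_eq_of_lt hip, List.getElem?_take_of_lt hip]
    · obtain ⟨j, rfl⟩ := Nat.exists_eq_add_of_le' hip
      rw [h j hi, ih j (by omega) (by omega), Nat.add_mod_right]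

theorem isPower_repeat {p s : List α} (hp : p ≠ []) :
    IsPower (p ++ s ++ p ++ s ++ p) (p ++ s)
      (((p ++ s ++ p ++ s ++ p).length : ℚ) / ((p ++ s).length : ℕ)) := by
  have h := isPower_of_period (v := p ++ s ++ p ++ s ++ p) (p := (p ++ s).length)
    (by have := List.length_pos_iff.2 hp; simp; omega) (by simp) (fun i hi => ?_)
  · rwa [show (p ++ s ++ p ++ s ++ p).take (p ++ s).length = p ++ s by
      rw [show p ++ s ++ p ++ s ++ p = (p ++ s) ++ (p ++ s ++ p) by simp, List.take_left]] at h
  · have e1 : (p ++ s ++ p ++ s ++ p)[i + (p ++ s).length]? = (p ++ s ++ p)[i]? := by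
      rw [show p ++ s ++ p ++ s ++ p = (p ++ s) ++ (p ++ s ++ p) by simp,
        List.getElem?_append_right (by omega), Nat.add_sub_cancel]
    have e2 : (p ++ s ++ p ++ s ++ p)[i]? = (p ++ s ++ p)[i]? := by
      rw [show p ++ s ++ p ++ s ++ p = (p ++ s ++ p) ++ (s ++ p) by simp,
        List.getElem?_append_left (by simp at hi ⊢; omega)]
    rw [e1, e2]

theorem mem_biFactors_of_isInfix {u : ℤ → α} {v x : List α} (hv : v ∈ biFactors u)
    (hx : x <:+: v) : x ∈ biFactors u := by
  obtain ⟨i, n, rfl⟩ := hv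
  obtain ⟨y, z, h⟩ := hx
  have hn := congrArg List.length h
  simp at hn
  refine ⟨i + y.length, x.length, List.ext_getElem (by simp) fun k h1 h2 => ?_⟩
  have h3 := congrArg (fun l => l[y.length + k]?) h
  simp only [List.append_assoc] at h3
  rw [List.getElem?_append_right (by omega), Nat.add_sub_cancel_left,
    List.getElem?_append_left h1, List.getElem?_eq_getElem h1,
    List.getElem?_eq_getElem (by simp; omega)] at h3
  simpa [add_assoc] using h3

theorem mem_factors_of_isInfix {u : ℕ → α} {v x : List α} (hv : v ∈ factors u)
    (hx : x <:+: v) : x ∈ factors u := by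
  obtain ⟨i, n, rfl⟩ := hv
  obtain ⟨y, z, h⟩ := hx
  have hn := congrArg List.length h
  simp at hn
  refine ⟨i + y.length, x.length, List.ext_getElem (by simp) fun k h1 h2 => ?_⟩
  have h3 := congrArg (fun l => l[y.length + k]?) h
  simp only [List.append_assoc] at h3
  rw [List.getElem?_append_right (by omega), Nat.add_sub_cancel_left,
    List.getElem?_append_left h1, List.getElem?_eq_getElem h1,
    List.getElem?_eq_getElem (by simp; omega)] at h3
  simpa [add_assoc] using h3

theorem agree_iff {n : ℕ} {x y : List (Fin 3)} : agree n x y = true ↔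
    n ≤ x.length ∧ n ≤ y.length ∧ ∀ i < n, x[i]? = y[i]? := by
  induction n generalizing x y with
  | zero => simp [agree]
  | succ n ih =>
    rcases x with _ | ⟨a, x⟩ <;> rcases y with _ | ⟨b, y⟩ <;> simp [agree, ih]
    constructor
    · rintro ⟨rfl, h1, h2, h3⟩
      refine ⟨h1, h2, fun i hi => ?_⟩
      cases i with
      | zero => rfl
      | succ i => simpa using h3 i (by omega)
    · rintro ⟨h1, h2, h3⟩
      exact ⟨by simpa using h3 0 (by omega), h1, h2, fun i hi => by simpa using h3 (i + 1) (by omega)⟩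

theorem startsRep_eq_false {L : Set (List (Fin 3))} (hL : ∀ v ∈ L, ∀ x, x <:+: v → x ∈ L)
    (hp : PowerFree (9 / 4) L) {w : List (Fin 3)} (hw : w ∈ L) : startsRep w = false := by
  by_contra h
  rw [Bool.not_eq_false, startsRep, List.any_eq_true] at h
  obtain ⟨⟨p, r⟩, hq, h⟩ := h
  have hpr : 0 < p ∧ 9 * p ≤ 4 * (p + r) := by
    simp only [List.mem_cons, Prod.mk.injEq, List.not_mem_nil, or_false] at hq
    omega
  obtain ⟨h1, -, h3⟩ := agree_iff.1 h
  simp only [List.length_drop] at h1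
  have hl : (w.take (p + r)).length = p + r := by simp; omega
  have := hp _ (hL w hw _ (List.take_prefix (p + r) w).isInfix) _ _
    (isPower_of_period hpr.1 (by omega) fun i hi => by
      rw [hl] at hi
      have := h3 i (by omega)
      rw [List.getElem?_drop] at this
      rw [List.getElem?_take_of_lt hi, List.getElem?_take_of_lt (by omega), ← this, add_comm])
  rw [hl, div_lt_iff₀ (by exact_mod_cast hpr.1)] at this
  have h9 : (9 * p : ℚ) ≤ 4 * (p + r : ℕ) := by exact_mod_cast hpr.2
  linarith

theorem isPal_iff {w : List (Fin 3)} : isPal w = true ↔ w.Palindrome := by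
  rw [isPal, beq_iff_eq, List.Palindrome.iff_reverse_eq]

theorem mem_foldr_insert {β : Type*} [BEq β] [LawfulBEq β] {l m : List β} {x : β} :
    x ∈ l.foldr List.insert m ↔ x ∈ l ∨ x ∈ m := by
  induction l with
  | nil => simp
  | cons a l ih => simp [ih, or_assoc]

theorem nodup_foldr_insert {β : Type*} [BEq β] [LawfulBEq β] {l m : List β} (hm : m.Nodup) :
    (l.foldr List.insert m).Nodup := by
  induction l with
  | nil => simpa
  | cons a l ih =>
    rw [List.foldr_cons]
    by_cases h : a ∈ l.foldr List.insert m
    · rwa [List.insert_of_mem h]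
    · rw [List.insert_of_not_mem h]
      exact List.nodup_cons.2 ⟨h, ih⟩

theorem nodup_shortPals (w : List (Fin 3)) : (shortPals w).Nodup := by
  induction w with
  | nil => simp [shortPals]
  | cons a w ih => exact nodup_foldr_insert ih

theorem of_mem_shortPals {w x : List (Fin 3)} (h : x ∈ shortPals w) :
    x <:+: w ∧ x.Palindrome := by
  induction w with
  | nil =>
    obtain rfl : x = [] := by simpa [shortPals] using h
    exact ⟨List.infix_rfl, .nil⟩
  | cons a w ih =>
    rw [shortPals, mem_foldr_insert, List.mem_filter, isPal_iff, List.mem_map] at h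
    rcases h with ⟨⟨k, -, rfl⟩, h⟩ | h
    · exact ⟨(List.take_prefix _ _).isInfix, h⟩
    · exact ⟨(ih h).1.trans (List.suffix_cons a w).isInfix, (ih h).2⟩

theorem palindromes_eq_sixPals {L : Set (List (Fin 3))} (hL : ∀ v ∈ L, ∀ x, x <:+: v → x ∈ L)
    (hp : PowerFree (9 / 4) L) (hn : numPalindromes L ≤ 6) {v : List (Fin 3)} (hv : v ∈ L)
    (hlen : v.length = 19) :
    ∃ a b, a ≠ b ∧ {w ∈ L | w.Palindrome} = {w | w ∈ sixPals a b} := by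
  obtain ⟨x, hx, hs⟩ := exists_suffix_of_leftSearch (by decide) leftSearch_haltPals hlen
  rw [List.append_nil] at hs
  have hxL := hL v hv x hx.isInfix
  have hsub : ∀ y ∈ shortPals x, y ∈ {w ∈ L | w.Palindrome} := fun y hy =>
    ⟨hL x hxL y (of_mem_shortPals hy).1, (of_mem_shortPals hy).2⟩
  simp only [haltPals, startsRep_eq_false hL hp hxL, Bool.false_or, Bool.and_eq_true,
    Bool.or_eq_true, decide_eq_true_eq] at hs
  have hcard : ∀ l : List (List (Fin 3)), l.Nodup → {w | w ∈ l}.encard = l.length := by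
    intro l hl
    rw [← List.toFinset_card_of_nodup hl, ← Set.encard_coe_eq_coe_finsetCard]
    simp
  rcases hs.2 with h | h
  · exfalso
    have h1 := Set.encard_le_encard (s := {w | w ∈ shortPals x}) hsub
    rw [hcard _ (nodup_shortPals x)] at h1
    have := h1.trans hn
    have h6 : (shortPals x).length ≤ 6 := by exact_mod_cast this
    omega
  · rw [List.any_eq_true] at h
    obtain ⟨⟨a, b⟩, hq, h⟩ := h
    rw [List.all_eq_true] at h
    have hab : a ≠ b ∧ (sixPals a b).Nodup := by
      simp only [List.mem_cons, Prod.mk.injEq, List.not_mem_nil, or_false] at hq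
      rcases hq with ⟨rfl, rfl⟩ | ⟨rfl, rfl⟩ | ⟨rfl, rfl⟩ <;> decide
    -- Six palindromes have been found and at most six are allowed, so there are no others.
    refine ⟨a, b, hab.1, (Set.Finite.eq_of_subset_of_encard_le ?_ ?_ ?_).symm⟩
    · exact List.finite_toSet _
    · intro y hy
      exact hsub y (by simpa using h y hy)
    · rw [hcard _ hab.2]
      exact hn

/-! ### Good words and reduction to the cyclic letter order -/

def n01 (v : List (Fin 3)) : ℕ := v.countP (· != 2)

/-- The word `p s p s p` has exponent at least `9/4`, both with respect to the length and with
respect to the number of letters other than `2`. -/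
def Heavy (p s : List (Fin 3)) : Prop :=
  p ≠ [] ∧ (p ++ s).length ≤ 4 * p.length ∧ n01 (p ++ s) ≤ 4 * n01 p

instance (p s : List (Fin 3)) : Decidable (Heavy p s) := by unfold Heavy; infer_instance

def HeavyFree (v : List (Fin 3)) : Prop :=
  ∀ p s, Heavy p s → ¬ (p ++ s ++ p ++ s ++ p) <:+: v

def CyclicPairs (v : List (Fin 3)) : Prop :=
  ∀ f ∈ [[0, 2], [1, 0], [2, 1], [2, 2]], ¬ f <:+: v

def Good (v : List (Fin 3)) : Prop := CyclicPairs v ∧ HeavyFree v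

theorem HeavyFree.mono {v w : List (Fin 3)} (h : HeavyFree v) (hw : w <:+: v) : HeavyFree w :=
  fun p s hps hi => h p s hps (hi.trans hw)

theorem CyclicPairs.mono {v w : List (Fin 3)} (h : CyclicPairs v) (hw : w <:+: v) :
    CyclicPairs w := fun f hf hi => h f hf (hi.trans hw)

theorem Good.mono {v w : List (Fin 3)} (h : Good v) (hw : w <:+: v) : Good w :=
  ⟨h.1.mono hw, h.2.mono hw⟩

theorem heavyFree_map {L : Set (List (Fin 3))} (hL : ∀ v ∈ L, ∀ x, x <:+: v → x ∈ L)
    (hp : PowerFree (9 / 4) L) (σ : Equiv.Perm (Fin 3)) {v : List (Fin 3)} (hv : v ∈ L) :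
    HeavyFree (v.map σ) := by
  intro p s ⟨h0, h1, _⟩ hi
  have hi' := hi.map σ.symm
  simp only [List.map_map, Equiv.symm_comp_self, List.map_id, List.map_append] at hi'
  have h2 := hp _ (hL v hv _ hi') _ _ (isPower_repeat (by simpa using h0))
  have h3 : 0 < (((p.map σ.symm ++ s.map σ.symm).length : ℕ) : ℚ) := by
    have := List.length_pos_iff.2 h0
    simp only [List.length_append, List.length_map]
    exact_mod_cast (by omega)
  rw [div_lt_iff₀ h3] at h2
  simp only [List.length_append, List.length_map, Nat.cast_add] at h1 h2
  have h4 : (p.length : ℚ) + s.length ≤ 4 * p.length := by exact_mod_cast h1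
  linarith

/-- `(a, b)` is a step of the cyclic order `0 → 1 → 2 → 0`, or `a = b ≠ 2`. -/
def okPair (a b : Fin 3) : Bool := ![![true, true, false], ![false, true, true], ![true, false, false]] a b

theorem cyclicPairs_iff {v : List (Fin 3)} :
    CyclicPairs v ↔ ∀ a b, [a, b] <:+: v → okPair a b = true := by
  constructor
  · intro h a b hab
    by_contra h'
    have key : ∀ a b, ¬ okPair a b = true → [a, b] ∈ [[0, 2], [1, 0], [2, 1], [2, 2]] := by decide
    exact h [a, b] (key a b h') hab
  · intro h f hf hi
    simp only [List.mem_cons, List.not_mem_nil, or_false] at hf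
    rcases hf with rfl | rfl | rfl | rfl <;> simpa [okPair] using h _ _ hi

/-- A pair aa fits both cyclic orders, but three consecutive letters contain a change of letter (aaa
is excluded) and so fix a direction. Excluding aba and abba forces overlapping triples to have the
same direction, which thus propagates along the whole line. -/
theorem forall_okPair_or {W : ℤ → Fin 3} (h : ∀ v ∈ biFactors W, v.Palindrome → v ∈ sixPals 0 1) :
    (∀ i, okPair (W i) (W (i + 1)) = true) ∨
      (∀ i, okPair (Equiv.swap 0 1 (W i)) (Equiv.swap 0 1 (W (i + 1))) = true) := by
  have hmem : ∀ i, [W i, W (i + 1), W (i + 2), W (i + 3)] ∈ biFactors W := fun i =>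
    ⟨i, 4, by simp [List.range_succ]⟩
  have key : ∀ a b c d : Fin 3,
      (∀ v : List (Fin 3), v <:+: [a, b, c, d] → v.Palindrome → v ∈ sixPals 0 1) →
      ((okPair a b && okPair b c) = (okPair b c && okPair c d)) ∧
      ((okPair (Equiv.swap 0 1 a) (Equiv.swap 0 1 b) &&
        okPair (Equiv.swap 0 1 b) (Equiv.swap 0 1 c)) =
        (okPair (Equiv.swap 0 1 b) (Equiv.swap 0 1 c) &&
        okPair (Equiv.swap 0 1 c) (Equiv.swap 0 1 d))) ∧
      ((okPair a b && okPair b c) || (okPair (Equiv.swap 0 1 a) (Equiv.swap 0 1 b) &&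
        okPair (Equiv.swap 0 1 b) (Equiv.swap 0 1 c))) = true := by
    have : ∀ a b c d : Fin 3,
      (∀ v ∈ [[a, b], [b, c], [a, b, c], [b, c, d], [c, d], [a, b, c, d]],
        v <:+: [a, b, c, d] → v.reverse = v → v ∈ sixPals 0 1) →
      ((okPair a b && okPair b c) = (okPair b c && okPair c d)) ∧
      ((okPair (Equiv.swap 0 1 a) (Equiv.swap 0 1 b) &&
        okPair (Equiv.swap 0 1 b) (Equiv.swap 0 1 c)) =
        (okPair (Equiv.swap 0 1 b) (Equiv.swap 0 1 c) &&
        okPair (Equiv.swap 0 1 c) (Equiv.swap 0 1 d))) ∧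
      ((okPair a b && okPair b c) || (okPair (Equiv.swap 0 1 a) (Equiv.swap 0 1 b) &&
        okPair (Equiv.swap 0 1 b) (Equiv.swap 0 1 c))) = true := by decide
    exact fun a b c d h => this a b c d fun v _ hv hr => h v hv (List.Palindrome.of_reverse_eq hr)
  have hk := fun i => key _ _ _ _ fun v hv hr =>
    h v (mem_biFactors_of_isInfix (hmem i) hv) hr
  have prop : ∀ P : ℤ → Bool, (∀ i, P i = P (i + 1)) → ∀ i, P i = P 0 := by
    intro P hP i
    induction i using Int.induction_on with
    | zero => rfl
    | succ i ih => rw [← hP, ih]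
    | pred i ih => rw [hP, sub_add_cancel, ih]
  have h1 := prop (fun i => okPair (W i) (W (i + 1)) && okPair (W (i + 1)) (W (i + 2)))
    fun i => by simpa [add_assoc] using (hk i).1
  have h2 := prop (fun i => okPair (Equiv.swap 0 1 (W i)) (Equiv.swap 0 1 (W (i + 1))) &&
      okPair (Equiv.swap 0 1 (W (i + 1))) (Equiv.swap 0 1 (W (i + 2))))
    fun i => by simpa [add_assoc] using (hk i).2.1
  have h3 := (hk 0).2.2
  rw [Bool.or_eq_true] at h3
  rcases h3 with h3 | h3
  · left
    intro i
    have := (h1 i).trans h3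
    exact (Bool.and_eq_true_iff.1 this).1
  · right
    intro i
    have := (h2 i).trans h3
    exact (Bool.and_eq_true_iff.1 this).1

theorem biFactors_comp {α β : Type*} (f : α → β) (u : ℤ → α) :
    biFactors (fun i => f (u i)) = List.map f '' biFactors u := by
  ext v
  constructor
  · rintro ⟨i, n, rfl⟩
    exact ⟨_, ⟨i, n, rfl⟩, by simp [Function.comp_def]⟩
  · rintro ⟨_, ⟨i, n, rfl⟩, rfl⟩
    exact ⟨i, n, by simp [Function.comp_def]⟩

theorem factors_comp {α β : Type*} (f : α → β) (u : ℕ → α) :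
    factors (fun i => f (u i)) = List.map f '' factors u := by
  ext v
  constructor
  · rintro ⟨i, n, rfl⟩
    exact ⟨_, ⟨i, n, rfl⟩, by simp [Function.comp_def]⟩
  · rintro ⟨_, ⟨i, n, rfl⟩, rfl⟩
    exact ⟨i, n, by simp [Function.comp_def]⟩

theorem cyclicPairs_of_mem_biFactors {W : ℤ → Fin 3}
    (h : ∀ i, okPair (W i) (W (i + 1)) = true) {v : List (Fin 3)} (hv : v ∈ biFactors W) :
    CyclicPairs v := by
  refine cyclicPairs_iff.2 fun a b hab => ?_
  obtain ⟨i, n, hi⟩ := mem_biFactors_of_isInfix hv hab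
  obtain rfl : n = 2 := by simpa using (congrArg List.length hi).symm
  simp only [List.range_succ, List.range_zero, List.nil_append, List.map_cons,
    List.map_nil, List.cons_append, List.cons.injEq, and_true] at hi
  rw [hi.1, hi.2]
  simpa using h i

theorem exists_perm_good {w : ℤ → Fin 3} (hp : PowerFree (9 / 4) (biFactors w))
    (hn : numPalindromes (biFactors w) ≤ 6) :
    ∃ σ : Equiv.Perm (Fin 3), ∀ v ∈ biFactors (fun i => σ (w i)), Good v := by
  have hL : ∀ v ∈ biFactors w, ∀ x, x <:+: v → x ∈ biFactors w :=
    fun v hv x hx => mem_biFactors_of_isInfix hv hx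
  obtain ⟨a, b, hab, hpal⟩ := palindromes_eq_sixPals hL hp hn (v := _) ⟨0, 19, rfl⟩ (by simp)
  have hD : ∀ σ : Equiv.Perm (Fin 3), ∀ v ∈ biFactors (fun i => σ (w i)), HeavyFree v := by
    intro σ v hv
    rw [biFactors_comp] at hv
    obtain ⟨v, hv, rfl⟩ := hv
    exact heavyFree_map hL hp σ hv
  obtain ⟨τ, hτ⟩ : ∃ τ : Equiv.Perm (Fin 3), ∀ x ∈ sixPals a b, x.map τ ∈ sixPals 0 1 := by
    have key : ∀ a b : Fin 3, a ≠ b →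
        ∃ τ : Equiv.Perm (Fin 3), ∀ x ∈ sixPals a b, x.map τ ∈ sixPals 0 1 := by decide
    exact key a b hab
  have hW : ∀ v ∈ biFactors (fun i => τ (w i)), v.Palindrome → v ∈ sixPals 0 1 := by
    intro v hv hpv
    rw [biFactors_comp] at hv
    obtain ⟨v, hv, rfl⟩ := hv
    refine hτ v ?_
    have : v ∈ {w_1 | w_1 ∈ biFactors w ∧ w_1.Palindrome} := by
      refine ⟨hv, List.Palindrome.of_reverse_eq ?_⟩
      have := hpv.reverse_eq
      rw [← List.map_reverse] at this
      exact List.map_injective_iff.2 τ.injective this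
    rw [hpal] at this
    exact this
  rcases forall_okPair_or hW with h | h
  · exact ⟨τ, fun v hv => ⟨cyclicPairs_of_mem_biFactors h hv, hD τ v hv⟩⟩
  · exact ⟨τ.trans (Equiv.swap 0 1), fun v hv =>
      ⟨cyclicPairs_of_mem_biFactors h hv, hD (τ.trans (Equiv.swap 0 1)) v hv⟩⟩

/-! ### Desubstitution of good words -/

theorem morph_append {α β : Type*} (f : α → List β) (x y : List α) :
    morph f (x ++ y) = morph f x ++ morph f y := List.flatMap_append

theorem morph_cons {α β : Type*} (f : α → List β) (a : α) (y : List α) :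
    morph f (a :: y) = f a ++ morph f y := List.flatMap_cons

theorem morph_infix {α β : Type*} (f : α → List β) {x y : List α} (h : x <:+: y) :
    morph f x <:+: morph f y := by
  obtain ⟨a, b, rfl⟩ := h
  exact ⟨morph f a, morph f b, by simp [morph_append]⟩

theorem iterate_morph_append (n : ℕ) (x y : List (Fin 3)) :
    (morph t)^[n] (x ++ y) = (morph t)^[n] x ++ (morph t)^[n] y := by
  induction n generalizing x y with
  | zero => rfl
  | succ n ih => simp only [Function.iterate_succ_apply, morph_append, ih]

theorem iterate_morph_infix (n : ℕ) {x y : List (Fin 3)} (h : x <:+: y) :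
    (morph t)^[n] x <:+: (morph t)^[n] y := by
  obtain ⟨a, b, rfl⟩ := h
  exact ⟨(morph t)^[n] a, (morph t)^[n] b, by simp [iterate_morph_append]⟩

theorem length_morph_le (x : List (Fin 3)) : (morph t x).length ≤ 5 * x.length := by
  induction x with
  | nil => simp [morph]
  | cons a x ih =>
    have : (t a).length ≤ 5 := by revert a; decide
    rw [morph_cons, List.length_append, List.length_cons]
    omega

theorem length_iterate_morph_le (n : ℕ) (x : List (Fin 3)) :
    ((morph t)^[n] x).length ≤ 5 ^ n * x.length := by
  induction n generalizing x with
  | zero => simp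
  | succ n ih =>
    rw [Function.iterate_succ_apply, pow_succ, mul_assoc]
    exact (ih _).trans (Nat.mul_le_mul_left _ (length_morph_le x))

theorem length_morph (x : List (Fin 3)) : (morph t x).length = x.length + 4 * n01 x := by
  induction x with
  | nil => simp [morph, n01]
  | cons a x ih =>
    rw [morph_cons, List.length_append, ih, n01, n01, List.countP_cons, List.length_cons]
    have : (t a).length = 1 + 4 * (if (a != 2) = true then 1 else 0) := by revert a; decide
    omega

theorem n01_append (x y : List (Fin 3)) : n01 (x ++ y) = n01 x + n01 y := List.countP_append

theorem n01_morph (x : List (Fin 3)) : n01 (morph t x) = 4 * n01 x := by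
  induction x with
  | nil => simp [morph, n01]
  | cons a x ih =>
    have h1 : n01 (t a) = 4 * (if (a != 2) = true then 1 else 0) := by revert a; decide
    have h2 : n01 (a :: x) = n01 x + (if (a != 2) = true then 1 else 0) := List.countP_cons ..
    rw [morph_cons, n01_append, ih, h1, h2]
    omega

/-- Under t the pair (length, `n01`) becomes (length + 4 `n01`, 4 `n01`). The map is linear with
nonnegative coefficients, so the two inequalities together are preserved, while the length
inequality alone need not be. -/
theorem Heavy.morph {p s : List (Fin 3)} (h : Heavy p s) : Heavy (morph t p) (morph t s) := by
  obtain ⟨h0, h1, h2⟩ := h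
  refine ⟨fun h => h0 ?_, ?_, ?_⟩
  · have := length_morph p
    rw [h] at this
    exact List.length_eq_zero_iff.1 (by simp at this; omega)
  · rw [← morph_append, length_morph, length_morph]
    omega
  · rw [← morph_append, n01_morph, n01_morph]
    omega

theorem Good.of_morph {v : List (Fin 3)} (h : Good (morph t v)) : Good v := by
  refine ⟨fun f hf hi => ?_, fun p s hps hi => ?_⟩
  · have hi' := morph_infix t hi
    have key : ∀ f ∈ ([[0, 2], [1, 0], [2, 1], [2, 2]] : List (List (Fin 3))),
        ∃ g ∈ ([[0, 2], [1, 0], [2, 1], [2, 2]] : List (List (Fin 3))), g <:+: morph t f := by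
      decide
    obtain ⟨g, hg, hg'⟩ := key f hf
    exact h.1 g hg (hg'.trans hi')
  · have hi' := morph_infix t hi
    simp only [morph_append] at hi'
    exact h.2 _ _ hps.morph hi'

theorem Good.not_forbidden {v : List (Fin 3)} (h : Good v) {f : List (Fin 3)}
    (hf : f ∈ forbidden) : ¬ f <:+: v := by
  -- The list holds the pairs (p, s) that exhibit the last ten forbidden words as `p s p s p`.
  have key : ∀ f ∈ forbidden, f ∈ [[0, 2], [1, 0], [2, 1], [2, 2]] ∨
      ∃ q ∈ ([([0], []), ([1], []), ([1], [2, 0]), ([0], [1, 2]), ([0], [1, 1, 2]),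
        ([1], [2, 0, 0]), ([0, 1], [1, 2, 0]), ([1, 2], [0, 0, 1]),
        ([0, 1], [1, 2, 0, 1, 2, 0]), ([1, 2, 0], [0, 1, 2, 0, 1])] :
          List (List (Fin 3) × List (Fin 3))),
        Heavy q.1 q.2 ∧ f = q.1 ++ q.2 ++ q.1 ++ q.2 ++ q.1 := by decide
  rcases key f hf with hf | ⟨q, -, hq, rfl⟩
  · exact h.1 f hf
  · exact h.2 _ _ hq

theorem Good.startsForbidden {v : List (Fin 3)} (h : Good v) : startsForbidden v = false := by
  by_contra h'
  rw [Bool.not_eq_false, PalWords.startsForbidden, List.any_eq_true] at h'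
  obtain ⟨f, hf, hi⟩ := h'
  exact h.not_forbidden hf (List.isPrefixOf_iff_prefix.1 hi).isInfix

theorem Good.cutStep {v : List (Fin 3)} (h : Good v) (hv : v.length = 25) : cutStep v = true := by
  obtain ⟨x, hx, hs⟩ := exists_suffix_of_leftSearch (by decide) leftSearch_cutStep hv
  rw [List.append_nil, (h.mono hx.isInfix).startsForbidden, Bool.false_or, Bool.and_eq_true,
    beq_iff_eq] at hs
  rw [← hx.eq_of_length (hs.1.trans hv.symm)]
  exact hs.2

theorem cut_mono {l l' r r' : List (Fin 3)} (h : cut l r = true) (hl : l <+: l') (hr : r <+: r') :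
    cut l' r' = true := by
  simp only [cut, List.any_eq_true, Bool.and_eq_true, List.isPrefixOf_iff_prefix] at h ⊢
  obtain ⟨q, hq, h1, h2⟩ := h
  exact ⟨q, hq, h1.trans hl, h2.trans hr⟩

/-- The rule inspects at most four letters on each side, so cutting the context down to four loses
nothing. -/
theorem cut_of_cut {l l' r r' : List (Fin 3)} (h : cut l' r' = true) (hl : l <+: l') (hr : r <+: r')
    (hl4 : 4 ≤ l.length) (hr4 : 4 ≤ r.length) : cut l r = true := by
  simp only [cut, List.any_eq_true, Bool.and_eq_true, List.isPrefixOf_iff_prefix] at h ⊢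
  obtain ⟨q, hq, h1, h2⟩ := h
  have : q.1.length ≤ 4 ∧ q.2.length ≤ 4 := by
    clear h1 h2
    revert q
    decide
  exact ⟨q, hq, List.prefix_of_prefix_length_le h1 hl (by omega),
    List.prefix_of_prefix_length_le h2 hr (by omega)⟩

/-- Blocks are split off Y from left to right. Each step applies `cutStep` to the last 10 letters
before the current boundary and the next 15 after it; Z is a reserve that keeps this window inside
the word. -/
theorem exists_morph_of_cut (Y : List (Fin 3)) : ∀ X Z : List (Fin 3), Good (X ++ Y ++ Z) →
    10 ≤ X.length → 15 ≤ Z.length → cut X.reverse (Y ++ Z) = true →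
    ∃ v s, Y = morph t v ++ s ∧ s.length < 5 := by
  induction h : Y.length using Nat.strong_induction_on generalizing Y with
  | _ n ih =>
    intro X Z hG hX hZ hc
    rcases lt_or_ge Y.length 5 with hY | hY
    · exact ⟨[], Y, rfl, hY⟩
    obtain ⟨X0, X1, rfl, hX1⟩ : ∃ X0 X1, X = X0 ++ X1 ∧ X1.length = 10 :=
      ⟨X.take (X.length - 10), X.drop (X.length - 10), by simp, by simp; omega⟩
    have hlen : (X1 ++ (Y ++ Z).take 15).length = 25 := by simp; omega
    have hG' : Good (X1 ++ (Y ++ Z).take 15) :=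
      hG.mono ⟨X0, (Y ++ Z).drop 15, by simp⟩
    have hs := hG'.cutStep hlen
    simp only [cutStep, cutAt, Bool.and_eq_true, Bool.or_eq_true, Bool.not_eq_true',
      List.any_eq_true] at hs
    have hd : ∀ k, (X1 ++ (Y ++ Z).take 15).drop (10 + k) = ((Y ++ Z).take 15).drop k := by
      intro k
      rw [← hX1, List.drop_append]
      simp
    have htk : ∀ k, (X1 ++ (Y ++ Z).take 15).take (10 + k) = X1 ++ ((Y ++ Z).take 15).take k := by
      intro k
      rw [← hX1, List.take_append]
      simp
    have hc' : cut ((X1 ++ (Y ++ Z).take 15).take (10 + 0)).reverse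
        ((X1 ++ (Y ++ Z).take 15).drop (10 + 0)) = true := by
      rw [hd, htk]
      refine cut_of_cut hc ?_ ?_ (by simp; omega) (by simp; omega)
      · simp
      · simpa using List.take_prefix 15 (Y ++ Z)
    rcases hs.2 with hs | ⟨a, -, ha, hs⟩
    · rw [add_zero] at hc'
      rw [hc'] at hs
      exact absurd hs (by simp)
    · have hd0 := hd 0
      rw [add_zero, List.drop_zero] at hd0
      rw [hd0, List.isPrefixOf_iff_prefix] at ha
      have ha5 : (t a).length ≤ 5 ∧ 1 ≤ (t a).length := by clear ha hs; revert a; decide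
      have haY : t a <+: Y := List.prefix_of_prefix_length_le
        (ha.trans (List.take_prefix _ _)) (List.prefix_append Y Z) (by omega)
      obtain ⟨Y1, rfl⟩ := haY
      have htl : ((t a ++ Y1 ++ Z).take 15).take (t a).length = t a := by
        rw [List.take_take, min_eq_left (by omega), List.append_assoc, List.take_left]
      rw [hd, htk, htl] at hs
      obtain ⟨v, s, rfl, hs5⟩ := ih Y1.length (by rw [← h]; simp; omega) Y1 rfl
        (X0 ++ X1 ++ t a) Z (by simpa using hG) (by simp; omega) hZ (by
          refine cut_mono hs (by simp) ?_
          rw [List.append_assoc]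
          refine (List.IsPrefix.drop (List.take_prefix 15 _) _).trans ?_
          simp)
      exact ⟨a :: v, s, by simp [morph_cons], hs5⟩

theorem Good.exists_morph {V : List (Fin 3)} (h : Good V) :
    ∃ p v s, V = p ++ morph t v ++ s ∧ p.length ≤ 30 ∧ s.length ≤ 30 ∧ Good v := by
  suffices H : ∃ p v s, V = p ++ morph t v ++ s ∧ p.length ≤ 30 ∧ s.length ≤ 30 by
    obtain ⟨p, v, s, rfl, hp, hs⟩ := H
    exact ⟨p, v, s, rfl, hp, hs, (h.mono ⟨p, s, rfl⟩).of_morph⟩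
  rcases lt_or_ge V.length 30 with hV | hV
  · exact ⟨V, [], [], by simp [morph], hV.le, by simp⟩
  have hs := (h.mono (List.take_prefix 25 V).isInfix).cutStep (by simp; omega)
  rw [PalWords.cutStep, Bool.and_eq_true, List.any_eq_true] at hs
  simp only [cutAt, List.mem_range] at hs
  obtain ⟨⟨j, hj, hc⟩, -⟩ := hs
  -- The left end has at most 14 letters, and the right end at most 4 unparsed ones plus the reserve
  -- of 15.
  obtain ⟨Y, Z, hYZ, hZ⟩ : ∃ Y Z, V.drop (10 + j) = Y ++ Z ∧ Z.length = 15 :=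
    ⟨(V.drop (10 + j)).take (V.length - (10 + j) - 15),
      (V.drop (10 + j)).drop (V.length - (10 + j) - 15), by simp, by simp; omega⟩
  have hX : V.take (10 + j) ++ Y ++ Z = V := by rw [List.append_assoc, ← hYZ, List.take_append_drop]
  obtain ⟨v, s, rfl, hs⟩ := exists_morph_of_cut Y (V.take (10 + j)) Z (by rwa [hX])
    (by simp; omega) hZ.ge (by
      rw [← hYZ]
      refine cut_mono hc ?_ (List.IsPrefix.drop (List.take_prefix 25 _) _)
      rw [List.take_take, min_eq_left (by omega)])
  exact ⟨V.take (10 + j), v, s ++ Z, by simpa using hX.symm, by simp; omega, by simp; omega⟩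

theorem Good.exists_iterate_morph (n : ℕ) : ∃ C : ℕ, ∀ V : List (Fin 3), Good V →
    ∃ p v s, V = p ++ (morph t)^[n] v ++ s ∧ p.length ≤ C ∧ s.length ≤ C ∧ Good v := by
  induction n with
  | zero => exact ⟨0, fun V h => ⟨[], V, [], by simp, by simp, by simp, h⟩⟩
  | succ n ih =>
    obtain ⟨C, hC⟩ := ih
    refine ⟨C + 5 ^ n * 30, fun V h => ?_⟩
    obtain ⟨p, v, s, rfl, hp, hs, hv⟩ := hC V h
    obtain ⟨p', v', s', rfl, hp', hs', hv'⟩ := hv.exists_morph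
    refine ⟨p ++ (morph t)^[n] p', v', (morph t)^[n] s' ++ s, ?_, ?_, ?_, hv'⟩
    · simp [iterate_morph_append]
    · have := (length_iterate_morph_le n p').trans (Nat.mul_le_mul_left _ hp')
      rw [List.length_append]
      omega
    · have := (length_iterate_morph_le n s').trans (Nat.mul_le_mul_left _ hs')
      rw [List.length_append]
      omega

/-! ### Short covers and equality of factor sets -/

theorem exists_short_cover (k : ℕ) (v : List (Fin 3)) {y : List (Fin 3)} (hv : CyclicPairs v)
    (hy : y <:+: (morph t)^[k] v) (hk : y.length ≤ 4 ^ k) :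
    ∃ x, x <:+: v ∧ x.length ≤ 3 ∧ y <:+: (morph t)^[k] x := by
  induction h : v.length using Nat.strong_induction_on generalizing v with
  | _ n ih =>
    subst h
    rcases le_or_gt v.length 3 with h3 | h3
    · exact ⟨v, List.infix_rfl, h3, hy⟩
    obtain ⟨a, v', rfl⟩ := List.exists_cons_of_length_pos (by omega : 0 < v.length)
    obtain rfl | ⟨mid, b, rfl⟩ := v'.eq_nil_or_concat
    · simp at h3
    simp only [List.concat_eq_append] at *
    have reduce : ∀ w, w <:+: a :: (mid ++ [b]) → w.length < (a :: (mid ++ [b])).length →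
        y <:+: (morph t)^[k] w →
        ∃ x, x <:+: a :: (mid ++ [b]) ∧ x.length ≤ 3 ∧ y <:+: (morph t)^[k] x := by
      intro w hw hlt hyw
      obtain ⟨x, hx, hx3, hyx⟩ := ih _ hlt w (hv.mono hw) hyw rfl
      exact ⟨x, hx.trans hw, hx3, hyx⟩
    have e1 : (morph t)^[k] (a :: (mid ++ [b])) =
        (morph t)^[k] [a] ++ (morph t)^[k] (mid ++ [b]) := iterate_morph_append k [a] _
    have e2 : (morph t)^[k] (a :: (mid ++ [b])) =
        (morph t)^[k] (a :: mid) ++ (morph t)^[k] [b] := iterate_morph_append k (a :: mid) [b]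
    have e3 : (morph t)^[k] (a :: mid) = (morph t)^[k] [a] ++ (morph t)^[k] mid :=
      iterate_morph_append k [a] mid
    obtain ⟨P, S, hPS⟩ := hy
    rcases le_or_gt ((morph t)^[k] [a]).length P.length with hP | hP
    · refine reduce (mid ++ [b]) (List.suffix_cons _ _).isInfix (by simp) ?_
      rw [e1, List.append_assoc] at hPS
      have := congrArg (List.drop ((morph t)^[k] [a]).length) hPS
      rw [List.drop_left, List.drop_append_of_le_length hP] at this
      exact ⟨_, S, by rw [← this, List.append_assoc]⟩
    rcases le_or_gt ((morph t)^[k] [b]).length S.length with hS | hS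
    · refine reduce (a :: mid) ⟨[], [b], by simp⟩ (by simp) ?_
      rw [e2] at hPS
      obtain ⟨S1, S2, rfl, hS2⟩ : ∃ S1 S2, S = S1 ++ S2 ∧ S2.length = ((morph t)^[k] [b]).length :=
        ⟨S.take (S.length - ((morph t)^[k] [b]).length),
          S.drop (S.length - ((morph t)^[k] [b]).length), by simp, by simp; omega⟩
      rw [← List.append_assoc] at hPS
      exact ⟨P, S1, (List.append_inj' hPS hS2).1⟩
    -- Now y meets the images of both outer letters, so it properly contains that of `mid`. As 22 is
    -- excluded, `mid` has a letter other than 2, whose image alone has 4^k letters other than 2: y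
    -- is too long.
    exfalso
    have hlen := congrArg List.length hPS
    rw [e2, e3] at hlen
    simp only [List.length_append] at hlen
    have hn : ∀ x, n01 ((morph t)^[k] x) = 4 ^ k * n01 x := by
      intro x
      clear * -
      induction k with
      | zero => simp
      | succ k ih => rw [Function.iterate_succ_apply', n01_morph, ih, pow_succ]; ring
    have h1 : n01 ((morph t)^[k] mid) ≤ ((morph t)^[k] mid).length := List.countP_le_length
    have h2 : 1 ≤ n01 mid := by
      rcases mid with _ | ⟨c, _ | ⟨d, mid⟩⟩
      · simp at h3
      · simp at h3
      · have hcd := cyclicPairs_iff.1 hv c d ⟨[a], mid ++ [b], by simp⟩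
        have key : ∀ c d, okPair c d = true → c ≠ 2 ∨ d ≠ 2 := by decide
        rw [n01, Nat.one_le_iff_ne_zero, Ne, List.countP_eq_zero]
        intro h0
        rcases key c d hcd with h | h
        · exact h0 c (by simp) (by simpa using h)
        · exact h0 d (by simp) (by simpa using h)
    rw [hn] at h1
    have := Nat.mul_le_mul_left (4 ^ k) h2
    omega

def CubeFree01 (v : List (Fin 3)) : Prop := ∀ f ∈ [[0, 0, 0], [1, 1, 1]], ¬ f <:+: v

instance (v : List (Fin 3)) : Decidable (CyclicPairs v) := by unfold CyclicPairs; infer_instance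
instance (v : List (Fin 3)) : Decidable (CubeFree01 v) := by unfold CubeFree01; infer_instance

theorem CubeFree01.mono {v w : List (Fin 3)} (h : CubeFree01 v) (hw : w <:+: v) :
    CubeFree01 w := fun f hf hi => h f hf (hi.trans hw)

theorem Good.cubeFree01 {v : List (Fin 3)} (h : Good v) : CubeFree01 v := by
  intro f hf
  exact h.not_forbidden (by revert f; decide)

theorem forall_of_length_le_three {P : List (Fin 3) → Prop} (h0 : P []) (h1 : ∀ a, P [a])
    (h2 : ∀ a b, P [a, b]) (h3 : ∀ a b c, P [a, b, c]) {x : List (Fin 3)} (hx : x.length ≤ 3) :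
    P x := by
  rcases x with _ | ⟨a, _ | ⟨b, _ | ⟨c, _ | ⟨d, x⟩⟩⟩⟩
  · exact h0
  · exact h1 a
  · exact h2 a b
  · exact h3 a b c
  · simp only [List.length_cons] at hx
    omega

theorem CyclicPairs.morph {v : List (Fin 3)} (h : CyclicPairs v) :
    CyclicPairs (morph t v) ∧ CubeFree01 (morph t v) := by
  have key : ∀ x : List (Fin 3), x.length ≤ 3 → CyclicPairs x →
      CyclicPairs (PalWords.morph t x) ∧ CubeFree01 (PalWords.morph t x) := fun x hx =>
    forall_of_length_le_three (P := fun x => CyclicPairs x →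
      CyclicPairs (PalWords.morph t x) ∧ CubeFree01 (PalWords.morph t x))
      (by decide +kernel) (by decide +kernel) (by decide +kernel) (by decide +kernel) hx
  have cover : ∀ f : List (Fin 3), f.length ≤ 4 → f <:+: PalWords.morph t v →
      ∃ x, x <:+: v ∧ x.length ≤ 3 ∧ f <:+: PalWords.morph t x :=
    fun f hf hi => exists_short_cover 1 v h hi (by simpa using hf)
  constructor <;> intro f hf hi
  · obtain ⟨x, hx, hx3, hfx⟩ := cover f (by clear hi; revert f; decide) hi
    exact (key x hx3 (h.mono hx)).1 f hf hfx
  · obtain ⟨x, hx, hx3, hfx⟩ := cover f (by clear hi; revert f; decide) hi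
    exact (key x hx3 (h.mono hx)).2 f hf hfx

theorem iterate_cyclicPairs (n : ℕ) :
    CyclicPairs ((morph t)^[n] [0]) ∧ CubeFree01 ((morph t)^[n] [0]) := by
  induction n with
  | zero => decide
  | succ n ih =>
    rw [Function.iterate_succ_apply']
    exact ih.1.morph

theorem iterate_eq_map_range (n : ℕ) : (morph t)^[n] [0] =
    (List.range ((morph t)^[n] [0]).length).map tOmega :=
  List.ext_getElem (by simp) fun k h1 h2 => by simp [tOmega_spec n k h1]

theorem mem_factors_tOmega {y : List (Fin 3)} :
    y ∈ factors tOmega ↔ ∃ n, y <:+: (morph t)^[n] [0] := by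
  constructor
  · rintro ⟨i, n, rfl⟩
    refine ⟨i + n, ((List.range i).map tOmega),
      (List.range (((morph t)^[i + n] [0]).length - (i + n))).map (fun k => tOmega (i + n + k)), ?_⟩
    have h := lt_length_iterate (i + n)
    conv_rhs => rw [iterate_eq_map_range, show ((morph t)^[i + n] [0]).length = i + n +
      (((morph t)^[i + n] [0]).length - (i + n)) by omega, List.range_add, List.range_add]
    simp [Function.comp_def]
  · rintro ⟨n, h⟩
    exact mem_factors_of_isInfix ⟨0, _, by simpa using iterate_eq_map_range n⟩ h

theorem morph_mem_factors_tOmega {x : List (Fin 3)} (hx : x ∈ factors tOmega) (n : ℕ) :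
    (morph t)^[n] x ∈ factors tOmega := by
  obtain ⟨m, hm⟩ := mem_factors_tOmega.1 hx
  refine mem_factors_tOmega.2 ⟨n + m, ?_⟩
  rw [Function.iterate_add_apply]
  exact iterate_morph_infix n hm

theorem short_mem_factors_tOmega {x : List (Fin 3)} (h : CyclicPairs x) (h' : CubeFree01 x)
    (hx : x.length ≤ 3) : x ∈ factors tOmega := by
  refine mem_factors_tOmega.2 ⟨3, ?_⟩
  exact forall_of_length_le_three (P := fun x => CyclicPairs x → CubeFree01 x →
      x <:+: (morph t)^[3] [0])
      (by decide +kernel) (by decide +kernel) (by decide +kernel) (by decide +kernel) hx h h'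

theorem biFactors_eq_factors_tOmega {W : ℤ → Fin 3} (hW : ∀ v ∈ biFactors W, Good v) :
    biFactors W = factors tOmega := by
  ext y
  constructor
  · rintro ⟨i, m, rfl⟩
    obtain ⟨C, hC⟩ := Good.exists_iterate_morph m
    -- A margin of C on each side keeps y clear of the unparsed ends. Taking m = |y| as the number
    -- of iterations gives |y| ≤ 4^m.
    obtain ⟨p, v, s, h, hp, hs, hv⟩ := hC _ (hW _ ⟨i - C, C + m + C, rfl⟩)
    have hy : (List.range m).map (fun k : ℕ => W (i + k)) <:+: (morph t)^[m] v := by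
      have hlen := congrArg List.length h
      simp only [List.length_map, List.length_range, List.length_append] at hlen
      refine ⟨((morph t)^[m] v).take (C - p.length),
        ((morph t)^[m] v).drop (C - p.length + m), ?_⟩
      have e : (List.range m).map (fun k : ℕ => W (i + k)) =
          (((morph t)^[m] v).drop (C - p.length)).take m := by
        refine List.ext_getElem (by simp; omega) fun k h1 h2 => ?_
        simp only [List.length_map, List.length_range] at h1
        have h3 := congrArg (fun l => l[C + k]?) h
        simp only [List.append_assoc] at h3
        rw [List.getElem?_append_right (by omega), List.getElem?_append_left (by omega),
          List.getElem?_eq_getElem (by simp; omega), List.getElem?_eq_getElem (by omega)] at h3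
        simp only [List.getElem_map, List.getElem_range, Option.some.injEq] at h3
        simp only [List.getElem_map, List.getElem_range, List.getElem_take, List.getElem_drop]
        rw [show i + (k : ℤ) = i - C + ((C + k : ℕ) : ℤ) by push_cast; ring, h3]
        congr 1
        omega
      rw [e, ← List.drop_drop, List.append_assoc, List.take_append_drop, List.take_append_drop]
    obtain ⟨x, hx, hx3, hyx⟩ := exists_short_cover m v hv.1 hy
      (by simpa using (Nat.lt_pow_self (by norm_num : 1 < 4)).le)
    have hx' := hv.mono hx
    exact mem_factors_of_isInfix (morph_mem_factors_tOmega
      (short_mem_factors_tOmega hx'.1 hx'.cubeFree01 hx3) m) hyx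
  · intro hy
    obtain ⟨n, hn⟩ := mem_factors_tOmega.1 hy
    obtain ⟨C, hC⟩ := Good.exists_iterate_morph n
    -- Since t^n stretches by a factor of at most 5^n, this length leaves at least four letters in
    -- v, among which 0 must occur.
    have hV : (List.range (2 * C + 5 ^ n * 4)).map (fun k : ℕ => W (0 + k)) ∈ biFactors W :=
      ⟨0, _, rfl⟩
    obtain ⟨p, v, s, h, hp, hs, hv⟩ := hC _ (hW _ hV)
    rw [h] at hV
    refine mem_biFactors_of_isInfix hV (hn.trans (List.IsInfix.trans ?_ ⟨p, s, rfl⟩))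
    refine iterate_morph_infix n ?_
    have hlen := congrArg List.length h
    simp only [List.length_map, List.length_range, List.length_append] at hlen
    have h4 : 4 ≤ v.length :=
      Nat.le_of_mul_le_mul_left ((by omega : 5 ^ n * 4 ≤ ((morph t)^[n] v).length).trans
        (length_iterate_morph_le n v)) (by positivity)
    have h5 : (v.take 4).length = 4 := by simp; omega
    obtain ⟨a, b, c, d, hab⟩ := List.length_eq_four.1 h5
    have hg := hv.mono (List.take_prefix 4 v).isInfix
    refine List.IsInfix.trans ?_ (List.take_prefix 4 v).isInfix
    have key : ∀ a b c d : Fin 3, CyclicPairs [a, b, c, d] → CubeFree01 [a, b, c, d] →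
        [0] <:+: [a, b, c, d] := by decide +kernel
    rw [hab] at hg ⊢
    exact key a b c d hg.1 hg.cubeFree01

/-! ### Palindromes of t^ω(0) -/

theorem palindromes_factors_tOmega :
    {w ∈ factors tOmega | w.Palindrome} = {w | w ∈ sixPals 0 1} := by
  ext w
  constructor
  · rintro ⟨hw, hp⟩
    obtain ⟨n, hn⟩ := mem_factors_tOmega.1 hw
    have h1 := (iterate_cyclicPairs n).1.mono hn
    have h2 := (iterate_cyclicPairs n).2.mono hn
    clear hn hw
    induction hp with
    | nil => simp [sixPals]
    | singleton a => revert a; decide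
    -- The inner palindrome is one of the six, so only finitely many extensions a l a need checking.
    | @cons_concat a l hl ih =>
      have hi : l <:+: a :: (l ++ [a]) := ⟨[a], [a], by simp⟩
      have h3 := ih (h1.mono hi) (h2.mono hi)
      have key : ∀ l ∈ sixPals 0 1, ∀ a, CyclicPairs (a :: (l ++ [a])) →
          CubeFree01 (a :: (l ++ [a])) → a :: (l ++ [a]) ∈ sixPals 0 1 := by decide +kernel
      exact key l h3 a h1 h2
  · intro hw
    have key : ∀ w ∈ sixPals 0 1, w.reverse = w ∧ CyclicPairs w ∧ CubeFree01 w ∧ w.length ≤ 3 := by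
      decide +kernel
    obtain ⟨h1, h2, h3, h4⟩ := key w hw
    exact ⟨short_mem_factors_tOmega h2 h3 h4, List.Palindrome.of_reverse_eq h1⟩

theorem numPalindromes_factors_tOmega : numPalindromes (factors tOmega) = 6 := by
  rw [numPalindromes, palindromes_factors_tOmega]
  have : {w | w ∈ sixPals 0 1} = ((sixPals 0 1).toFinset : Set (List (Fin 3))) := by simp
  rw [this, Set.encard_coe_eq_coe_finsetCard, List.toFinset_card_of_nodup (by decide)]
  rfl

/-! ### Block structure of t^ω(0) and absence of overlaps -/

/-- The position in `t^ω(0)` at which the image of its `n`-th letter begins. -/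
def blockStart (n : ℕ) : ℕ := (morph t ((List.range n).map tOmega)).length

theorem blockStart_succ (n : ℕ) : blockStart (n + 1) = blockStart n + (t (tOmega n)).length := by
  rw [blockStart, List.range_succ, List.map_append, morph_append, List.length_append]
  simp [blockStart, morph]

theorem morph_map_range (n : ℕ) :
    morph t ((List.range n).map tOmega) = (List.range (blockStart n)).map tOmega := by
  have h : (List.range n).map tOmega <+: (morph t)^[n] [0] := by
    rw [iterate_eq_map_range n]
    have := lt_length_iterate n
    refine List.IsPrefix.map _ ?_
    rw [List.prefix_iff_eq_take, List.length_range, List.take_range, min_eq_left this.le]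
  obtain ⟨z, hz⟩ := h
  have h2 : morph t ((List.range n).map tOmega) <+: (morph t)^[n + 1] [0] := by
    rw [Function.iterate_succ_apply', ← hz, morph_append]
    exact List.prefix_append _ _
  refine List.ext_getElem (by simp [blockStart]) fun k h3 h4 => ?_
  rw [h2.getElem h3, tOmega_spec]
  simp

theorem tOmega_block (n j : ℕ) (hj : j < (t (tOmega n)).length) :
    tOmega (blockStart n + j) = (t (tOmega n))[j] := by
  have h := congrArg (fun l => l[blockStart n + j]?) (morph_map_range (n + 1))
  rw [List.range_succ, List.map_append, morph_append, morph_map_range,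
    List.getElem?_append_right (by simp)] at h
  simp only [List.length_map, List.length_range, Nat.add_sub_cancel_left, List.map_cons,
    List.map_nil] at h
  rw [show morph t [tOmega n] = t (tOmega n) by simp [morph], List.getElem?_eq_getElem hj,
    List.getElem?_eq_getElem (by simp [blockStart_succ]; omega)] at h
  simpa using h.symm

theorem map_range_blockStart (n m : ℕ) :
    (List.range (blockStart (n + m) - blockStart n)).map (fun k => tOmega (blockStart n + k)) =
      morph t ((List.range m).map fun k => tOmega (n + k)) := by
  have h := morph_map_range (n + m)
  have hle : blockStart n ≤ blockStart (n + m) := by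
    simp only [blockStart, List.range_add, List.map_append, morph_append, List.length_append]
    omega
  rw [List.range_add, List.map_append, morph_append, morph_map_range,
    show blockStart (n + m) = blockStart n + (blockStart (n + m) - blockStart n) by omega,
    List.range_add, List.map_append] at h
  have := List.append_cancel_left h
  simpa [Function.comp_def] using this.symm

theorem blockStart_lt_succ (n : ℕ) : blockStart n < blockStart (n + 1) := by
  rw [blockStart_succ]
  have : ∀ a, 0 < (t a).length := by decide
  exact Nat.lt_add_of_pos_right (this _)

theorem blockStart_succ_le (n : ℕ) : blockStart (n + 1) ≤ blockStart n + 5 := by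
  rw [blockStart_succ]
  have : ∀ a, (t a).length ≤ 5 := by decide
  exact Nat.add_le_add_left (this _) _

theorem blockStart_strictMono : StrictMono blockStart := strictMono_nat_of_lt_succ blockStart_lt_succ

theorem exists_block (k : ℕ) : ∃ n, blockStart n ≤ k ∧ k < blockStart (n + 1) := by
  induction k with
  | zero => exact ⟨0, by decide, (Nat.zero_le _).trans_lt (blockStart_lt_succ 0)⟩
  | succ k ih =>
    obtain ⟨n, h1, h2⟩ := ih
    rcases Nat.lt_or_ge (k + 1) (blockStart (n + 1)) with h | h
    · exact ⟨n, by omega, h⟩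
    · exact ⟨n + 1, h, by have := blockStart_lt_succ (n + 1); omega⟩

theorem factor_tOmega (i n : ℕ) : CyclicPairs ((List.range n).map fun k => tOmega (i + k)) ∧
    CubeFree01 ((List.range n).map fun k => tOmega (i + k)) := by
  obtain ⟨m, hm⟩ := mem_factors_tOmega.1 ⟨i, n, rfl⟩
  exact ⟨(iterate_cyclicPairs m).1.mono hm, (iterate_cyclicPairs m).2.mono hm⟩

theorem okPair_tOmega (n : ℕ) : okPair (tOmega n) (tOmega (n + 1)) = true :=
  cyclicPairs_iff.1 (factor_tOmega n 2).1 _ _ (by simp [List.range_succ])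

theorem lt_blockStart_add (n : ℕ) {k : ℕ} (hk : 2 ≤ k) : blockStart n + k < blockStart (n + k) := by
  induction k, hk using Nat.le_induction with
  | base =>
    rw [show n + 2 = n + 1 + 1 from rfl, blockStart_succ, blockStart_succ, add_assoc]
    have key : ∀ a b, okPair a b = true → 2 < (t a).length + (t b).length := by decide
    exact Nat.add_lt_add_left (key _ _ (okPair_tOmega n)) _
  | succ k _ ih =>
    have := blockStart_lt_succ (n + k)
    rw [show n + (k + 1) = n + k + 1 from rfl]
    omega

/-- The local rule `cut` recognises the beginnings of the blocks in the image of a word. -/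
def windowCut (k : ℕ) : Bool := cutAt ((List.range 8).map fun j => tOmega (k - 4 + j)) 4

/-- The window around a position in the block of c lies within the images of five letters a b c d e,
which leaves a finite check. The first two blocks lack two predecessors and are treated by hand. -/
theorem windowCut_iff {k : ℕ} (hk : 4 ≤ k) : windowCut k = true ↔ ∃ n, blockStart n = k := by
  obtain ⟨n, h1, h2⟩ := exists_block k
  obtain ⟨j, rfl⟩ := Nat.exists_eq_add_of_le h1
  have hj : j < (t (tOmega n)).length := by rw [blockStart_succ] at h2; omega
  have hR : (∃ m, blockStart m = blockStart n + j) ↔ j = 0 := by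
    constructor
    · rintro ⟨m, hm⟩
      have h3 : blockStart m < blockStart (n + 1) := by omega
      have h4 : n < m + 1 := by
        by_contra h
        have := blockStart_strictMono (show m < n by omega)
        omega
      have := blockStart_strictMono.lt_iff_lt.1 h3
      obtain rfl : m = n := by omega
      omega
    · rintro rfl
      exact ⟨n, rfl⟩
  rw [hR]
  have key : ∀ a b c d e : Fin 3, CyclicPairs [a, b, c, d, e] → CubeFree01 [a, b, c, d, e] →
      ∀ j ∈ List.range (t c).length,
        (cutAt (((morph t [a, b, c, d, e]).drop ((t a ++ t b).length + j - 4)).take 8) 4 = true ↔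
          j = 0) := by decide +kernel
  rcases Nat.lt_or_ge n 2 with hn | hn
  · have h5 : (t (tOmega 0)).length = 5 ∧ (t (tOmega 1)).length = 5 ∧ blockStart 0 = 0 ∧
        blockStart 1 = 5 := by decide +kernel
    have key' : ∀ k ∈ [4, 5, 6, 7, 8, 9], (windowCut k = true ↔ k = 5) := by decide +kernel
    obtain rfl | rfl : n = 0 ∨ n = 1 := by omega
    · rw [key' _ (by simp; omega)]
      omega
    · rw [key' _ (by simp; omega)]
      omega
  · obtain ⟨m, rfl⟩ := Nat.exists_eq_add_of_le' hn
    have hT := map_range_blockStart m 5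
    have hf := factor_tOmega m 5
    simp only [List.range_succ, List.range_zero, List.nil_append, List.map_cons, List.map_nil,
      List.cons_append, Nat.add_zero] at hT hf
    rw [← key _ _ _ _ _ hf.1 hf.2 j (List.mem_range.2 hj), ← hT, windowCut]
    have e1 : blockStart (m + 2) = blockStart m + (t (tOmega m) ++ t (tOmega (m + 1))).length := by
      rw [List.length_append, ← add_assoc, ← blockStart_succ, ← blockStart_succ]
    have e2 := lt_blockStart_add m (le_refl 2)
    have e3 := lt_blockStart_add (m + 2 + 1) (le_refl 2)
    have hd : ∀ N d : ℕ, d + 8 ≤ N → ∀ f : ℕ → Fin 3,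
        (((List.range N).map f).drop d).take 8 = (List.range 8).map fun i => f (d + i) := by
      intro N d hN f
      exact List.ext_getElem (by simp; omega) fun i h1 h2 => by simp
    have h4 : 4 ≤ (t (tOmega m) ++ t (tOmega (m + 1))).length + j := by
      rw [e1] at hk
      have := okPair_tOmega m
      have key'' : ∀ a b, okPair a b = true → 4 ≤ (t a ++ t b).length := by decide
      have := key'' _ _ this
      omega
    rw [hd _ _ (by rw [show m + 2 + 1 + 2 = m + 5 from rfl] at e3; omega)]
    rw [show blockStart (m + 2) + j - 4 =
      blockStart m + ((t (tOmega m) ++ t (tOmega (m + 1))).length + j - 4) by omega]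
    simp only [add_assoc]

def hasShortOverlap (w : List (Fin 3)) : Bool :=
  w.tails.any fun z => [1, 2, 3, 4, 5, 6, 7, 8, 9, 10].any fun p => agree (p + 1) (z.drop p) z

/-- The overlap has 2p + 1 ≤ 21 ≤ 4^3 letters, so it lies in t^3(x) for some x of at most three
letters. -/
theorem tOmega_no_short_overlap {p : ℕ} (hp : 0 < p) (hp10 : p ≤ 10) (i : ℕ) :
    ¬ ∀ j ≤ p, tOmega (i + j) = tOmega (i + j + p) := by
  intro h
  obtain ⟨n, hn⟩ := mem_factors_tOmega.1 ⟨i, 2 * p + 1, rfl⟩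
  have hn3 := hn.trans (iterate_prefix (Nat.le_add_left n 3)).isInfix
  rw [Function.iterate_add_apply] at hn3
  obtain ⟨x, hx, hx3, z, z', hz⟩ := exists_short_cover 3 _ (iterate_cyclicPairs n).1 hn3
    (by simp; omega)
  have key : hasShortOverlap ((morph t)^[3] x) = false :=
    forall_of_length_le_three (P := fun x => CyclicPairs x → CubeFree01 x →
      hasShortOverlap ((morph t)^[3] x) = false)
      (by decide +kernel) (by decide +kernel) (by decide +kernel) (by decide +kernel) hx3
      ((iterate_cyclicPairs n).1.mono hx) ((iterate_cyclicPairs n).2.mono hx)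
  rw [← Bool.not_eq_true] at key
  apply key
  rw [hasShortOverlap, List.any_eq_true]
  refine ⟨(List.range (2 * p + 1)).map (fun k => tOmega (i + k)) ++ z', ?_, ?_⟩
  · rw [List.mem_tails, ← hz]
    exact ⟨z, by simp⟩
  · rw [List.any_eq_true]
    refine ⟨p, by simp; omega, agree_iff.2 ⟨by simp; omega, by simp; omega, fun k hk => ?_⟩⟩
    rw [List.getElem?_drop, List.getElem?_append_left (by simp; omega),
      List.getElem?_append_left (by simp; omega), List.getElem?_eq_getElem (by simp; omega),
      List.getElem?_eq_getElem (by simp; omega)]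
    simp only [List.getElem_map, List.getElem_range, Option.some.injEq]
    rw [h k (by omega)]
    congr 1
    omega

theorem tOmega_no_overlap {p : ℕ} (hp : 0 < p) (i : ℕ) :
    ¬ ∀ j ≤ p, tOmega (i + j) = tOmega (i + j + p) := by
  induction p using Nat.strong_induction_on generalizing i with
  | _ p ih =>
    intro h
    rcases Nat.lt_or_ge 10 p with hp10 | hp10
    swap
    · exact tOmega_no_short_overlap hp hp10 i h
    have h' : ∀ k, i ≤ k → k ≤ i + p → tOmega k = tOmega (k + p) := by
      intro k h1 h2
      obtain ⟨j, rfl⟩ := Nat.exists_eq_add_of_le h1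
      exact h j (by omega)
    obtain ⟨I, hI1, hI2⟩ := exists_block i
    -- The next boundary lies between i + 4 and i + 8. As p > 10, its eight-letter window lies in
    -- the range compared by `h'`, so its shift by p is again a boundary.
    obtain ⟨n', hn1, hn2⟩ := exists_block (i + 3)
    have hn3 := blockStart_succ_le n'
    obtain ⟨n, hn⟩ : ∃ n, n = n' + 1 := ⟨_, rfl⟩
    rw [← hn] at hn2 hn3
    obtain ⟨m, hm⟩ : ∃ m, blockStart m = blockStart n + p := by
      rw [← windowCut_iff (by omega)]
      have hw : windowCut (blockStart n) = true := (windowCut_iff (by omega)).2 ⟨n, rfl⟩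
      rw [← hw, windowCut, windowCut]
      congr 1
      refine List.map_congr_left fun j hj => ?_
      rw [List.mem_range] at hj
      rw [h' (blockStart n - 4 + j) (by omega) (by omega)]
      congr 1
      omega
    have hnm : n < m := blockStart_strictMono.lt_iff_lt.1 (by omega)
    obtain ⟨q, rfl⟩ := Nat.exists_eq_add_of_lt hnm
    have hIn : I ≤ n := by
      by_contra hlt
      have := blockStart_strictMono (show n < I by omega)
      omega
    have hpos : ∀ a, 0 < (t a).length := by decide
    have hlast : ∀ a b : Fin 3, (t a)[(t a).length - 1]? = (t b)[(t b).length - 1]? → a = b := by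
      decide
    have hfirst : ∀ a b : Fin 3, (t a)[0]? = (t b)[0]? → a = b := by decide
    -- The images end in distinct letters, so matching is carried leftwards block by block, down to
    -- block I, of which the overlap may cover only an end.
    have back : ∀ e, I + e ≤ n → blockStart (n - e + (q + 1)) = blockStart (n - e) + p ∧
        (0 < e → tOmega (n - e) = tOmega (n - e + (q + 1))) := by
      intro e
      induction e with
      | zero => exact fun _ => ⟨hm, fun h0 => absurd h0 (lt_irrefl 0)⟩
      | succ e ihe =>
        intro he
        have h1 := (ihe (by omega)).1
        obtain ⟨a, ha⟩ : ∃ a, n - e = a + 1 := ⟨n - e - 1, by omega⟩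
        rw [ha, show a + 1 + (q + 1) = a + (q + 1) + 1 by omega] at h1
        rw [show n - (e + 1) = a by omega]
        have ha1 : blockStart (I + 1) ≤ blockStart (a + 1) :=
          blockStart_strictMono.monotone (by omega)
        have ha2 : blockStart (a + 1) ≤ blockStart n :=
          blockStart_strictMono.monotone (by omega)
        have b1 := blockStart_succ a
        have b2 := blockStart_succ (a + (q + 1))
        have p1 := hpos (tOmega a)
        have p2 := hpos (tOmega (a + (q + 1)))
        have c1 := tOmega_block a ((t (tOmega a)).length - 1) (by omega)
        have c2 := tOmega_block (a + (q + 1)) ((t (tOmega (a + (q + 1)))).length - 1) (by omega)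
        have c3 := h' (blockStart a + ((t (tOmega a)).length - 1)) (by omega) (by omega)
        rw [show blockStart a + ((t (tOmega a)).length - 1) + p =
          blockStart (a + (q + 1)) + ((t (tOmega (a + (q + 1)))).length - 1) by omega, c1, c2] at c3
        have := hlast (tOmega a) (tOmega (a + (q + 1))) (by
          rw [List.getElem?_eq_getElem (by omega), List.getElem?_eq_getElem (by omega), c3])
        rw [← this] at b2
        exact ⟨by omega, fun _ => this⟩
    -- The images also begin with distinct letters, so a block is identified rightwards as soon as
    -- its first letter is compared.
    have forth : ∀ e, blockStart (n + e) ≤ i + p →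
        blockStart (n + e + (q + 1)) = blockStart (n + e) + p ∧
        tOmega (n + e) = tOmega (n + e + (q + 1)) := by
      have letter : ∀ a, n ≤ a → blockStart a ≤ i + p →
          blockStart (a + (q + 1)) = blockStart a + p → tOmega a = tOmega (a + (q + 1)) := by
        intro a hna hap ha
        have ha1 : blockStart n ≤ blockStart a := blockStart_strictMono.monotone hna
        have p1 := hpos (tOmega a)
        have p2 := hpos (tOmega (a + (q + 1)))
        have c1 := tOmega_block a 0 p1
        have c2 := tOmega_block (a + (q + 1)) 0 p2
        have c3 := h' (blockStart a) (by omega) hap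
        rw [← ha, ← Nat.add_zero (blockStart a), c1,
          ← Nat.add_zero (blockStart (a + (q + 1))), c2] at c3
        exact hfirst _ _ (by
          rw [List.getElem?_eq_getElem p1, List.getElem?_eq_getElem p2, c3])
      intro e
      induction e with
      | zero => exact fun he => ⟨hm, letter n le_rfl he hm⟩
      | succ e ihe =>
        intro he
        have b1 := blockStart_succ (n + e)
        have b2 := blockStart_succ (n + e + (q + 1))
        obtain ⟨h1, h2⟩ := ihe (by rw [← add_assoc] at he; omega)
        rw [← h2] at b2
        have h3 : blockStart (n + (e + 1) + (q + 1)) = blockStart (n + (e + 1)) + p := by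
          rw [show n + (e + 1) + (q + 1) = n + e + (q + 1) + 1 by omega, ← add_assoc n e 1]
          omega
        exact ⟨h3, letter _ (by omega) he h3⟩
    have hIn' : I < n := blockStart_strictMono.lt_iff_lt.1 (by omega)
    have hIp : blockStart (I + (q + 1)) = blockStart I + p := by
      have := (back (n - I) (by omega)).1
      rwa [show n - (n - I) = I by omega] at this
    have hqp : q + 1 < p := by
      rcases Nat.lt_or_ge (q + 1) 2 with h2 | h2
      · omega
      · have := lt_blockStart_add I h2
        omega
    -- The letters of t^ω(0) from index I on form an overlap of period q + 1. For j ≤ q + 1, block I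
    -- + j starts no later than `blockStart I + p`, which is at most i + p, so `forth` applies
    -- wherever `back` does not.
    refine ih (q + 1) hqp (by omega) I fun j hj => ?_
    rcases Nat.lt_or_ge (I + j) n with hj' | hj'
    · have := (back (n - (I + j)) (by omega)).2 (by omega)
      rwa [show n - (n - (I + j)) = I + j by omega] at this
    · have hle : blockStart (I + j) ≤ blockStart (I + (q + 1)) :=
        blockStart_strictMono.monotone (by omega)
      have := (forth (I + j - n) (by rw [show n + (I + j - n) = I + j by omega]; omega)).2
      rwa [show n + (I + j - n) = I + j by omega] at this

theorem powerPlusFree_tOmega : PowerPlusFree 2 (factors tOmega) := by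
  rintro v ⟨i, n, rfl⟩ u e ⟨hu, h, rfl⟩
  have hu' := List.length_pos_iff.2 hu
  by_contra hlt
  rw [not_le, lt_div_iff₀ (by exact_mod_cast hu')] at hlt
  simp only [List.length_map, List.length_range] at h hlt
  have hn : 2 * u.length < n := by exact_mod_cast hlt
  refine tOmega_no_overlap hu' i fun j hj => ?_
  have h1 := h j (by omega)
  have h2 := h (j + u.length) (by omega)
  rw [Nat.add_mod_right, ← h1, List.getElem?_eq_getElem (by simp; omega),
    List.getElem?_eq_getElem (by simp; omega)] at h2
  simpa [add_assoc] using h2.symm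

end PalWords

theorem theorem5 :
    (PalWords.numPalindromes (PalWords.factors PalWords.tOmega) = 6 ∧
      PalWords.PowerPlusFree 2 (PalWords.factors PalWords.tOmega)) ∧
    ∀ w : ℤ → Fin 3,
      PalWords.PowerFree (9 / 4) (PalWords.biFactors w) →
      PalWords.numPalindromes (PalWords.biFactors w) ≤ 6 →
      ∃ σ : Equiv.Perm (Fin 3),
        PalWords.biFactors w = PalWords.factors (fun n : ℕ => σ (PalWords.tOmega n)) := by
  refine ⟨⟨PalWords.numPalindromes_factors_tOmega, PalWords.powerPlusFree_tOmega⟩,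
    fun w hp hn => ?_⟩
  obtain ⟨σ, hσ⟩ := PalWords.exists_perm_good hp hn
  refine ⟨σ.symm, ?_⟩
  rw [PalWords.factors_comp, ← PalWords.biFactors_eq_factors_tOmega hσ, ← PalWords.biFactors_comp]
  simp
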